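/- Let $n\ge 1$ and consider the directed ring with node set $\mathbb{Z}_n$ and links $(v,v+1)$. A quantum one-way distributed algorithm with set of colors $\Sigma$ is given by numbers of qubits $w,m$, a unitary $U$ on $\mathcal{H}=\mathcal{H}_{\mathsf W}\otimes\mathcal{H}_{\mathsf M}$, where $\mathcal{H}_{\mathsf W}=(\mathbb{C}^2)^{\otimes w}$ (workspace) and $\mathcal{H}_{\mathsf M}=(\mathbb{C}^2)^{\otimes m}$ (message), and a projective measurement $\{\Pi_\sigma\}_{\sigma\in\Sigma}$ on $\mathcal{H}$; all nodes use the same $U$ and the same measurement. Every node holds one copy of $\mathcal{H}$, initially with all qubits in the state $|0\rangle$. In a round, every node applies $U$ to its memory, and then the message register of every node $v$ is passed to its successor $v+1$, i.e. the unitary $V\colon\bigotimes_v|b_v,c_v\rangle\mapsto\bigotimes_v|b_v,c_{v-1}\rangle$ is applied. After the last round, every node $v$ measures its memory with $\{\Pi_\sigma\}$ and outputs the outcome as its color; thus after $r$ rounds the coloring $\phi\colon\mathbb{Z}_n\to\Sigma$ is output with probability $\big\|\bigl(\bigotimes_v\Pi_{\phi(v)}\bigr)(VU^{\otimes n})^r|0\cdots0\rangle\big\|^2$.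 A coloring $\phi$ is proper if $\phi(v)\ne\phi(v+1)$ for all $v$. Theorem. If $|\Sigma|=3$, then every such algorithm with a single round ($r=1$) outputs a proper coloring of the $n$-node ring with probability at most $\left(\frac{11}{15}\right)^{\lfloor n/10\rfloor}$. In particular, this probability is exponentially small in $n$. -/

import Mathlib

namespace QuantumRing

/-- Computational basis of a register of `k` qubits. -/
abbrev Qubits (k : ℕ) : Type := Fin k → Fin 2

/-- Computational basis of the memory of one node: a workspace register of `w` qubits
together with a message register of `m` qubits. -/
abbrev NodeBasis (w m : ℕ) : Type := Qubits w × Qubits m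

/-- Computational basis of the joint memory of the nodes of the directed `n`-node ring, whose
nodes are the elements of `ZMod n` and whose arcs are the pairs `(v, v + 1)`. -/
abbrev RingBasis (n w m : ℕ) : Type := ZMod n → NodeBasis w m

/-- A one-way quantum distributed algorithm with outputs in `Color`: the (anonymous) local
program that every node executes. `U` is the local unitary applied before each communication
round, and `P` is the final local projective measurement. -/
structure OneWayAlgorithm (Color : Type) [Fintype Color] where
  /-- number of qubits of the workspace register -/
  w : ℕ
  /-- number of qubits of the message register -/
  m : ℕ
  /-- local operation -/
  U : Matrix (NodeBasis w m) (NodeBasis w m) ℂ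
  /-- `U` is unitary -/
  unitary : U ∈ Matrix.unitaryGroup (NodeBasis w m) ℂ
  /-- final measurement operators -/
  P : Color → Matrix (NodeBasis w m) (NodeBasis w m) ℂ
  /-- each measurement operator is self-adjoint ... -/
  selfAdjoint : ∀ c, (P c).IsHermitian
  /-- ... and idempotent, -/
  idempotent : ∀ c, P c * P c = P c
  /-- distinct measurement operators are mutually orthogonal, -/
  orthogonal : ∀ c d, c ≠ d → P c * P d = 0
  /-- and they sum to the identity. -/
  complete : ∑ c, P c = 1

/-- The tensor product, over all nodes `v`, of the local operators `T v`, as a matrix in the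
computational basis. -/
def tensorOp {n : ℕ} [NeZero n] {w m : ℕ}
    (T : ZMod n → Matrix (NodeBasis w m) (NodeBasis w m) ℂ) :
    Matrix (RingBasis n w m) (RingBasis n w m) ℂ :=
  fun x y => ∏ v, T v (x v) (y v)

/-- One round of communication on basis states: every node keeps its workspace register and
receives the message register of the node preceding it. -/
def passMessages {n w m : ℕ} (x : RingBasis n w m) : RingBasis n w m :=
  fun v => ((x v).1, (x (v - 1)).2)

/-- The messaging unitary: the linear extension of `passMessages`. -/
def messaging (n w m : ℕ) [NeZero n] : Matrix (RingBasis n w m) (RingBasis n w m) ℂ :=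
  fun x y => if x = passMessages y then 1 else 0

/-- The joint initial state: all qubits of all nodes are in the state `|0⟩`. -/
def initialState (n w m : ℕ) [NeZero n] : RingBasis n w m → ℂ :=
  Pi.single (fun _ => (fun _ => 0, fun _ => 0)) 1

/-- A coloring of the ring is proper if adjacent nodes have different colors. -/
def IsProper {n : ℕ} {Color : Type} (φ : ZMod n → Color) : Prop :=
  ∀ v, φ v ≠ φ (v + 1)

namespace OneWayAlgorithm

variable {Color : Type} [Fintype Color]

/-- The joint state of the ring after `r` communication rounds, right before the
measurement. -/
def finalState (A : OneWayAlgorithm Color) (n : ℕ) [NeZero n] (r : ℕ) :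
    RingBasis n A.w A.m → ℂ :=
  Matrix.mulVec ((messaging n A.w A.m * tensorOp (fun _ => A.U)) ^ r) (initialState n A.w A.m)

/-- The probability that, executed on the `n`-node ring for `r` rounds, the algorithm outputs the
coloring `φ`, i.e. that the local measurement of each node `v` has outcome `φ v`. -/
noncomputable def outputProb (A : OneWayAlgorithm Color) (n : ℕ) [NeZero n] (r : ℕ)
    (φ : ZMod n → Color) : ℝ :=
  ∑ x, ‖Matrix.mulVec (tensorOp (fun v => A.P (φ v))) (A.finalState n r) x‖ ^ 2

open Classical in
/-- The probability that the coloring output by the algorithm is proper. -/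
noncomputable def successProb (A : OneWayAlgorithm Color) (n : ℕ) [NeZero n] (r : ℕ) : ℝ :=
  ∑ φ : ZMod n → Color with IsProper φ, A.outputProb n r φ

end OneWayAlgorithm

end QuantumRing

namespace QuantumRing

/-! After one round the output is a 1-dependent process: word probabilities are traces of matrix
products, and summing out one node gives a rank-one factor that separates its two sides
(`isMatrixProduct_colorMatrix`). Fix a color of density `p` and repetition probability `e`. The
probability `f k` of avoiding it on `k` nodes satisfies `f (k + 3) ≤ f (k + 2) - p f (k + 1) + e f
k`. If `e` is too small for `p`, this recurrence oscillates and turns negative, which is absurd;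
hence a linear lower bound on `e` (`repetition_lower_bound`). Summed over three colors, adjacent
nodes agree with probability at least 0.0983. Disjoint pairs separated by one node are independent,
so the bound is a power (`sum_blocksProper_le`). -/

/-! ### Sign of a third-order recurrence. -/

/-- Runs the linear recurrence `c (k + 1) = c k - (P / S) c (k - 1) + (E / S) c (k - 2)`, rescaled
to integers, for at most the given number of steps, and tests whether it reaches a negative term.
The arguments `x`, `y`, `z` are the rescaled `c i`, `c (i + 1) - c i`, `(E / S) c (i - 1)`. -/
def reachesNeg (S P E : ℤ) : ℕ → ℤ → ℤ → ℤ → Bool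
  | 0, x, _, _ => decide (x < 0)
  | n + 1, x, y, z => decide (x < 0) || reachesNeg S P E n (S * (x + y)) (S * z - P * x) (E * x)

/-- A nonnegative sequence with `h (k + 3) ≤ h (k + 2) - (P / S) h (k + 1) + (E / S) h k` is
dominated by the corresponding linear recurrence until that recurrence becomes negative. -/
lemma not_reachesNeg_of_recurrence {S P E : ℤ} (hS : 0 < S) {h : ℕ → ℝ} (h0 : h 0 = 0)
    (h1 : h 1 = 0) (hnn : ∀ k, 0 ≤ h k)
    (hrec : ∀ k, S * h (k + 3) ≤ S * h (k + 2) - P * h (k + 1) + E * h k) (n : ℕ) :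
    ∀ (i : ℕ) (x y z : ℤ),
      (∀ m, (S : ℝ) ^ i * h (m + 2 + i) ≤ x * h (m + 2) + y * h (m + 1) + z * h m) →
      0 < h 2 → reachesNeg S P E n x y z = false := by
  have hSr : (0 : ℝ) < S := by exact_mod_cast hS
  have key : ∀ (i : ℕ) (x y z : ℤ),
      (∀ m, (S : ℝ) ^ i * h (m + 2 + i) ≤ x * h (m + 2) + y * h (m + 1) + z * h m) →
      0 < h 2 → 0 ≤ x := by
    intro i x y z hb h2
    have hb0 := hb 0
    simp only [zero_add, h0, h1, mul_zero, add_zero] at hb0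
    have : (0 : ℝ) ≤ x * h 2 := le_trans (by have := hnn (2 + i); positivity) hb0
    exact_mod_cast nonneg_of_mul_nonneg_left this h2
  induction n with
  | zero =>
    intro i x y z hb h2
    simpa [reachesNeg] using key i x y z hb h2
  | succ n ih =>
    intro i x y z hb h2
    have hx := key i x y z hb h2
    have hxr : (0 : ℝ) ≤ x := by exact_mod_cast hx
    simp only [reachesNeg, Bool.or_eq_false_iff, decide_eq_false_iff_not, not_lt]
    refine ⟨hx, ih (i + 1) _ _ _ (fun m => ?_) h2⟩
    have e1 := mul_le_mul_of_nonneg_left (hb (m + 1)) hSr.le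
    -- Only the leading coefficient multiplies the recurrence, so the signs of `y` and `z` are
    -- irrelevant.
    have e2 := mul_le_mul_of_nonneg_left (hrec m) hxr
    have e3 : m + 2 + (i + 1) = m + 1 + 2 + i := by ring
    rw [e3, pow_succ]
    push_cast
    have e4 : m + 1 + 2 = m + 3 := by ring
    have e5 : m + 1 + 1 = m + 2 := by ring
    rw [e4, e5] at e1
    rw [e4]
    nlinarith [e1, e2]

/-- Breakpoints, in units of `1 / 10000`, between which the density of a symbol is located. -/
def breakpoints : List ℤ :=
  [2562, 2605, 2656, 2716, 2786, 2866, 2955, 3053, 3157, 3263, 3366, 3459, 3536, 3602, 3662, 3717,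
   3771, 3825, 3879, 3938, 4000, 4072, 4156, 4253, 4384, 4553, 4806, 5210, 5992, 7721, 10000]

/-- Consecutive breakpoints `P`, `P'` are so close that a density at least `P / 10000` is
incompatible with a repetition probability at most `(17 P' - 4356) / 400000`. -/
def breakpointsClose : ℤ → List ℤ → Bool
  | _, [] => true
  | P, P' :: l =>
    reachesNeg 400000 (40 * P) (17 * P' - 43560) 30 1 0 0 && breakpointsClose P' l

lemma breakpointsClose_breakpoints :
    breakpointsClose 2562 breakpoints.tail = true := by
  decide +kernel

/-- A linear lower bound on the probability `e` of a repetition of a symbol of density `p`. -/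
lemma linear_bound_of_recurrence {p e : ℝ} {h : ℕ → ℝ} (h0 : h 0 = 0) (h1 : h 1 = 0)
    (h2 : h 2 = 1) (hnn : ∀ k, 0 ≤ h k)
    (hrec : ∀ k, h (k + 3) ≤ h (k + 2) - p * h (k + 1) + e * h k) (he : 0 ≤ e) (hp : p ≤ 1) :
    17 / 40 * p - 1089 / 10000 ≤ e := by
  have main : ∀ (l : List ℤ) (P : ℤ), breakpointsClose P l = true → (P : ℝ) / 10000 ≤ p →
      p ≤ ((l.getLastD P : ℤ) : ℝ) / 10000 → l ≠ [] → 17 / 40 * p - 1089 / 10000 ≤ e := by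
    intro l
    induction l with
    | nil => intro P _ _ _ h; exact absurd rfl h
    | cons P' l ih =>
      intro P hl hPp hlast _
      rw [breakpointsClose, Bool.and_eq_true] at hl
      rw [List.getLastD_cons] at hlast
      by_cases hnext : (P' : ℝ) / 10000 ≤ p ∧ l ≠ []
      · exact ih P' hl.2 hnext.1 hlast hnext.2
      · have hpP : p ≤ (P' : ℝ) / 10000 := by
          by_contra! hlt
          have hnil : l = [] := by simpa [hlt.le] using hnext
          subst hnil
          exact absurd hlast (not_le.mpr (by simpa using hlt))
        by_contra! hlt
        have hlt' : e ≤ 17 / 40 * ((P' : ℝ) / 10000) - 1089 / 10000 := by linarith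
        -- Worst case on the interval: `P / 10000` bounds `p` below, and `(17 * P' - 43560) /
        -- 400000`, the line at the right endpoint, bounds `e` above.
        have := not_reachesNeg_of_recurrence (S := 400000) (P := 40 * P)
          (E := 17 * P' - 43560) (by norm_num) h0 h1 hnn (fun k => ?_) 30 0 1 0 0
          (fun m => by simp) (by rw [h2]; norm_num)
        · rw [hl.1] at this; cases this
        · push_cast
          nlinarith [hrec k, mul_le_mul_of_nonneg_right hPp (hnn (k + 1)),
            mul_le_mul_of_nonneg_right hlt' (hnn k)]
  by_cases hp0 : (2562 : ℝ) / 10000 ≤ p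
  · refine main breakpoints.tail 2562 breakpointsClose_breakpoints (by push_cast; exact hp0) ?_
      (by simp [breakpoints])
    have : breakpoints.tail.getLastD 2562 = 10000 := rfl
    rw [this]
    norm_num
    exact hp
  -- Here the line is negative, so `he` suffices.
  · push Not at hp0
    linarith

/-! ### Stationary 1-dependent matrix-product processes. -/

open Matrix
open scoped ComplexOrder

/-- A family of matrices, indexed by symbols, whose products describe a stationary 1-dependent
process: their sum `D` has rank one and trace one, and every word has nonnegative weight. -/
structure IsMatrixProduct {ι C : Type} [Fintype ι] [DecidableEq ι] [Fintype C]
    (N : C → Matrix ι ι ℂ) : Prop where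
  sum_mul_mul_sum : ∀ X, (∑ c, N c) * X * (∑ c, N c) = trace ((∑ c, N c) * X) • ∑ c, N c
  trace_sum : trace (∑ c, N c) = 1
  nonneg : ∀ l : List C, 0 ≤ trace ((∑ c, N c) * (l.map N).prod)

/-- Reading a word in consecutive blocks of three, the last two letters of each of the first `j`
blocks are distinct. -/
def BlocksProper {C : Type} : ℕ → List C → Prop
  | 0, _ => True
  | j + 1, _ :: b :: c :: l => b ≠ c ∧ BlocksProper j l
  | _ + 1, _ => False

lemma blocksProper_of_isChain {C : Type} (j : ℕ) (l : List C) (hl : l.IsChain (· ≠ ·))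
    (hj : 3 * j ≤ l.length) : BlocksProper j l := by
  induction j generalizing l with
  | zero => simp [BlocksProper]
  | succ j ih =>
    match l, hl, hj with
    | a :: b :: c :: l, hl, hj =>
      simp only [List.isChain_cons_cons] at hl
      refine ⟨hl.2.1, ih l hl.2.2.of_cons ?_⟩
      simp only [List.length_cons] at hj
      omega

lemma sum_fin_succ_fun {C M : Type} [Fintype C] [AddCommMonoid M] {n : ℕ}
    (f : (Fin (n + 1) → C) → M) : ∑ φ, f φ = ∑ a, ∑ φ : Fin n → C, f (Fin.cons a φ) := by
  rw [← Fintype.sum_prod_type', ← (Fin.consEquiv (fun _ => C)).sum_comp]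
  rfl

section Words

variable {R C : Type} [Ring R] [Fintype C] (N : C → R)

lemma sum_prod_ofFn (r : ℕ) :
    ∑ φ : Fin r → C, ((List.ofFn φ).map N).prod = (∑ c, N c) ^ r := by
  induction r with
  | zero => simp
  | succ r ih =>
    rw [sum_fin_succ_fun, pow_succ', ← ih, Finset.sum_mul_sum]
    simp [List.ofFn_succ]

-- The free first letter of each block sums to `∑ c, N c`, which makes the blocks independent.
open Classical in
lemma sum_blocksProper [DecidableEq C] (j r : ℕ) :
    ∑ φ : Fin (r + 3 * j) → C,
        (if BlocksProper j (List.ofFn φ) then ((List.ofFn φ).map N).prod else 0) =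
      ((∑ c, N c) * ∑ a, ∑ b, if a ≠ b then N a * N b else 0) ^ j * (∑ c, N c) ^ r := by
  induction j with
  | zero => simpa [BlocksProper] using sum_prod_ofFn N r
  | succ j ih =>
    change ∑ φ : Fin (r + 3 * j + 1 + 1 + 1) → C, _ = _
    rw [sum_fin_succ_fun, pow_succ', mul_assoc _ (_ ^ j), ← ih]
    simp_rw [sum_fin_succ_fun (n := r + 3 * j + 1), sum_fin_succ_fun (n := r + 3 * j)]
    simp only [List.ofFn_succ, Fin.cons_zero, Fin.cons_succ, BlocksProper, List.map_cons,
      List.prod_cons]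
    rw [mul_assoc, Finset.sum_mul]
    refine Finset.sum_congr rfl fun a _ => ?_
    rw [Finset.sum_mul, Finset.mul_sum]
    refine Finset.sum_congr rfl fun b _ => ?_
    rw [Finset.sum_mul, Finset.mul_sum]
    refine Finset.sum_congr rfl fun c _ => ?_
    rw [Finset.mul_sum, Finset.mul_sum]
    refine Finset.sum_congr rfl fun φ _ => ?_
    by_cases hbc : b = c
    · simp [hbc]
    · simp [hbc, mul_assoc]

end Words

namespace IsMatrixProduct

variable {ι C : Type} [Fintype ι] [Fintype C] {N : C → Matrix ι ι ℂ}

/-- The weight of a word, extended linearly. -/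
noncomputable def weight (N : C → Matrix ι ι ℂ) (X : Matrix ι ι ℂ) : ℂ := trace ((∑ c, N c) * X)

lemma weight_sub (X Y : Matrix ι ι ℂ) : weight N (X - Y) = weight N X - weight N Y := by
  simp [weight, mul_sub]

lemma weight_sum {κ : Type} (s : Finset κ) (X : κ → Matrix ι ι ℂ) :
    weight N (∑ i ∈ s, X i) = ∑ i ∈ s, weight N (X i) := by
  simp [weight, Finset.mul_sum]

variable [DecidableEq ι] (hN : IsMatrixProduct N)
include hN

lemma weight_one : weight N 1 = 1 := by
  simpa [weight] using hN.trace_sum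

/-- This is 1-dependence: an unobserved letter decouples its two sides. -/
lemma weight_mul_sum_mul (X Y : Matrix ι ι ℂ) :
    weight N (X * (∑ c, N c) * Y) = weight N X * weight N Y := by
  rw [weight, ← mul_assoc, ← mul_assoc, hN.sum_mul_mul_sum, smul_mul, trace_smul, smul_eq_mul]
  rfl

lemma weight_sum_mul (Y : Matrix ι ι ℂ) : weight N ((∑ c, N c) * Y) = weight N Y := by
  simpa [hN.weight_one] using hN.weight_mul_sum_mul 1 Y

lemma weight_mul_pow_nonneg [DecidableEq C] (c : C) (j : ℕ) (l : List C) :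
    0 ≤ weight N ((l.map N).prod * ((∑ c, N c) - N c) ^ j) := by
  induction j generalizing l with
  | zero => simpa [weight] using hN.nonneg l
  | succ j ih =>
    have : (∑ c, N c) - N c = ∑ b ∈ Finset.univ.erase c, N b := by
      rw [← Finset.sum_erase_add _ _ (Finset.mem_univ c), add_sub_cancel_right]
    rw [pow_succ', ← mul_assoc, congrArg ((l.map N).prod * ·) this, Finset.mul_sum,
      Finset.sum_mul, weight_sum]
    refine Finset.sum_nonneg fun b _ => ?_
    simpa using ih (l ++ [b])

lemma weight_avoid_succ (c : C) (X : Matrix ι ι ℂ) (j : ℕ) :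
    weight N (X * ((∑ c, N c) - N c) ^ (j + 1)) =
      weight N X * weight N (((∑ c, N c) - N c) ^ j) -
        weight N (X * N c * ((∑ c, N c) - N c) ^ j) := by
  rw [pow_succ', ← hN.weight_mul_sum_mul, ← weight_sub]
  congr 1
  noncomm_ring

lemma repetition_lower_bound [DecidableEq C] (c : C) :
    17 / 40 * (weight N (N c)).re - 1089 / 10000 ≤ (weight N (N c * N c)).re := by
  set z := (∑ c, N c) - N c with hz
  have p_nonneg : 0 ≤ weight N (N c) := by simpa using hN.weight_mul_pow_nonneg c 0 [c]
  have e_nonneg : 0 ≤ weight N (N c * N c) := by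
    simpa using hN.weight_mul_pow_nonneg c 0 [c, c]
  have f_nonneg (k : ℕ) : 0 ≤ weight N (z ^ k) := by
    simpa using hN.weight_mul_pow_nonneg c k []
  have t_nonneg (k : ℕ) : 0 ≤ weight N (N c * N c * N c * z ^ k) := by
    simpa [mul_assoc] using hN.weight_mul_pow_nonneg c k [c, c, c]
  have avoid := hN.weight_avoid_succ c
  rw [← hz] at avoid
  have f0 : weight N (z ^ 0) = 1 := by rw [pow_zero, hN.weight_one]
  have fs (k : ℕ) : weight N (z ^ (k + 1)) = weight N (z ^ k) - weight N (N c * z ^ k) := by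
    simpa [hN.weight_one] using avoid 1 k
  have as (k : ℕ) := avoid (N c) k
  have aas (k : ℕ) := avoid (N c * N c) k
  simp only [Complex.le_def, Complex.zero_re, Complex.zero_im]
    at p_nonneg e_nonneg f_nonneg t_nonneg
  have f1 : (weight N (z ^ 1)).re = 1 - (weight N (N c)).re := by
    rw [fs, f0]; simp
  -- The avoidance probabilities are shifted by three and preceded by 0, 0, 1, which extends the
  -- recurrence backwards.
  refine linear_bound_of_recurrence (h := fun k => match k with
    | 0 => 0
    | 1 => 0
    | 2 => 1
    | k + 3 => (weight N (z ^ k)).re) rfl rfl rfl ?_ ?_ e_nonneg.1 ?_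
  · rintro (_ | _ | _ | k)
    · exact le_rfl
    · exact le_rfl
    · exact zero_le_one
    · exact (f_nonneg k).1
  · rintro (_ | _ | _ | k)
    · simp [hN.weight_one]
    · simp only
      rw [f1, f0]
      simp
    · simp only
      have h1 := fs 1
      have h2 := as 0
      rw [f0] at h2 ⊢
      simp only [pow_zero, mul_one] at h2
      norm_num at h1 h2 ⊢
      rw [h1, h2]
      norm_num
    -- Three expansions of `z` as `∑ c, N c` minus `N c`; the leftover weight of `c c c` followed by
    -- `k` other letters is dropped by sign.
    · have h1 := fs (k + 2)
      have h2 := as (k + 1)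
      have h3 := aas k
      change (weight N (z ^ (k + 2 + 1))).re ≤ (weight N (z ^ (k + 2))).re -
        _ * (weight N (z ^ (k + 1))).re + _ * (weight N (z ^ k)).re
      rw [h1, h2, h3]
      simp only [Complex.sub_re, Complex.mul_re, ← p_nonneg.2, ← e_nonneg.2]
      linarith [(t_nonneg k).1]
  · linarith [(f_nonneg 1).1]

lemma weight_ne_eq [DecidableEq C] :
    weight N (∑ a, ∑ b, if a ≠ b then N a * N b else 0) =
      1 - ∑ c, weight N (N c * N c) := by
  have h : (∑ a, ∑ b, if a ≠ b then N a * N b else 0) =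
      (∑ c, N c) * 1 * (∑ c, N c) - ∑ c, N c * N c := by
    rw [mul_one, Finset.sum_mul_sum, ← Finset.sum_sub_distrib]
    refine Finset.sum_congr rfl fun a _ => ?_
    rw [← Finset.add_sum_erase _ (fun b => N a * N b) (Finset.mem_univ a), add_sub_cancel_left,
      ← Finset.sum_filter]
    congr 1
    ext b
    simp [eq_comm]
  rw [h, weight_sub, weight_sum, mul_assoc, hN.weight_sum_mul, one_mul]
  simpa [hN.weight_one] using hN.weight_sum_mul 1

/-- The positive exponent `r + 1` supplies the rank-one factor that cuts the cycle open. -/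
lemma trace_pow_mul_pow (X : Matrix ι ι ℂ) (j r : ℕ) :
    trace (((∑ c, N c) * X) ^ j * (∑ c, N c) ^ (r + 1)) = weight N X ^ j := by
  have hr : (∑ c, N c) ^ (r + 1) = ∑ c, N c := by
    induction r with
    | zero => simp
    | succ r ih =>
      rw [pow_succ, ih]
      simpa [hN.trace_sum] using hN.sum_mul_mul_sum 1
  have hj : ((∑ c, N c) * X) ^ j * (∑ c, N c) = weight N X ^ j • ∑ c, N c := by
    induction j with
    | zero => simp
    | succ j ih =>
      rw [pow_succ', mul_assoc, ih, mul_smul_comm, hN.sum_mul_mul_sum, smul_smul, pow_succ]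
      rfl
  rw [hr, hj, trace_smul, hN.trace_sum, smul_eq_mul, mul_one]

omit hN [Fintype C] in
lemma sum_repetition_ge {N : Fin 3 → Matrix ι ι ℂ} (hN : IsMatrixProduct N) :
    983 / 10000 ≤ ∑ c, (weight N (N c * N c)).re := by
  have h1 : ∑ c, (weight N (N c)).re = 1 := by
    rw [← Complex.re_sum, ← weight_sum]
    simpa [hN.weight_one] using congrArg Complex.re (hN.weight_sum_mul 1)
  have := Finset.sum_le_sum fun c (_ : c ∈ Finset.univ) => hN.repetition_lower_bound c
  rw [Finset.sum_sub_distrib, ← Finset.mul_sum, h1] at this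
  -- The densities sum to 1, and 17/40 - 3 · 1089/10000 = 983/10000.
  refine le_trans ?_ this
  norm_num

omit hN [Fintype C] in
open Classical in
/-- Three-symbol words satisfying `BlocksProper` are exponentially unlikely. -/
lemma sum_blocksProper_le {N : Fin 3 → Matrix ι ι ℂ} (hN : IsMatrixProduct N) (q n : ℕ)
    (hn : 9 * q < n) :
    (∑ φ : Fin n → Fin 3, if BlocksProper (3 * q) (List.ofFn φ) then
      (trace ((List.ofFn φ).map N).prod).re else 0) ≤ (11 / 15 : ℝ) ^ q := by
  obtain ⟨r, rfl⟩ : ∃ r, n = (r + 1) + 3 * (3 * q) := ⟨n - 9 * q - 1, by omega⟩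
  have h := congrArg (fun X => (trace X).re) (sum_blocksProper N (3 * q) (r + 1))
  simp only [hN.trace_pow_mul_pow] at h
  have hre : weight N (∑ a, ∑ b, if a ≠ b then N a * N b else 0) =
      ((1 - ∑ c, (weight N (N c * N c)).re : ℝ) : ℂ) := by
    rw [hN.weight_ne_eq]
    push_cast
    congr 1
    refine Finset.sum_congr rfl fun c _ => ?_
    have : 0 ≤ weight N (N c * N c) := by simpa using hN.weight_mul_pow_nonneg c 0 [c, c]
    exact Complex.ext rfl (by simp [← (Complex.nonneg_iff.mp this).2])
  have hnn : 0 ≤ 1 - ∑ c, (weight N (N c * N c)).re := by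
    have : 0 ≤ weight N (∑ a, ∑ b, if a ≠ b then N a * N b else 0) := by
      simp only [weight_sum]
      refine Finset.sum_nonneg fun a _ => Finset.sum_nonneg fun b _ => ?_
      split_ifs
      · simpa using hN.weight_mul_pow_nonneg a 0 [a, b]
      · simp [weight]
    rw [hre] at this
    exact_mod_cast this
  rw [hre, ← Complex.ofReal_pow, Complex.ofReal_re, Matrix.trace_sum, Complex.re_sum] at h
  refine le_trans (le_of_eq ?_) (h.le.trans ?_)
  · refine Finset.sum_congr rfl fun φ _ => ?_
    split_ifs <;> simp
  · rw [pow_mul]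
    refine pow_le_pow_left₀ (by positivity) ?_ q
    -- Three blocks give one factor: 0.9017³ is just below 11/15.
    calc _ ≤ (1 - 983 / 10000 : ℝ) ^ 3 :=
          pow_le_pow_left₀ hnn (by linarith [hN.sum_repetition_ge]) 3
      _ ≤ _ := by norm_num

end IsMatrixProduct

/-! ### Traces, tensor products and transfer matrices. -/

lemma vecMulVec_mul_mul_vecMulVec {ι : Type} [Fintype ι] (d ρ : ι → ℂ) (X : Matrix ι ι ℂ) :
    vecMulVec d ρ * X * vecMulVec d ρ = trace (vecMulVec d ρ * X) • vecMulVec d ρ := by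
  rw [vecMulVec_mul, vecMulVec_mul_vecMulVec, trace_vecMulVec, dotProduct_comm]
  ext i j
  simp [vecMulVec_apply, mul_left_comm]

lemma prod_ofFn_apply {ι R : Type} [Fintype ι] [DecidableEq ι] [CommRing R] (k : ℕ)
    (M : Fin (k + 1) → Matrix ι ι R) (a b : ι) :
    (List.ofFn M).prod a b = ∑ x : Fin k → ι, ∏ i,
      M i ((Fin.cons a x : Fin (k + 1) → ι) i) ((Fin.snoc x b : Fin (k + 1) → ι) i) := by
  induction k generalizing a with
  | zero => simp [Fin.snoc]
  | succ k ih =>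
    rw [List.ofFn_succ, List.prod_cons, mul_apply, sum_fin_succ_fun]
    refine Finset.sum_congr rfl fun c _ => ?_
    rw [ih, Finset.mul_sum]
    refine Finset.sum_congr rfl fun x _ => ?_
    rw [Fin.prod_univ_succ (n := k + 1)]
    congr 1
    refine Finset.prod_congr rfl fun i _ => ?_
    rw [← Fin.cons_snoc_eq_snoc_cons, Fin.cons_succ, Fin.cons_succ]

/-- The trace of a product of matrices is a sum over closed walks. -/
lemma trace_prod_ofFn {ι R : Type} [Fintype ι] [DecidableEq ι] [CommRing R] (k : ℕ)
    (M : Fin (k + 1) → Matrix ι ι R) :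
    trace (List.ofFn M).prod = ∑ x : Fin (k + 1) → ι, ∏ i, M i (x i) (x (i + 1)) := by
  rw [sum_fin_succ_fun, trace]
  refine Finset.sum_congr rfl fun a _ => ?_
  rw [diag_apply, prod_ofFn_apply]
  refine Finset.sum_congr rfl fun x _ => Finset.prod_congr rfl fun i _ => ?_
  refine congrArg (M i _) ((congrFun (Fin.snoc_eq_cons_rotate x a) i).trans ?_)
  rw [finRotate_apply]

section TensorOp

variable {n : ℕ} [NeZero n] {w m : ℕ}

lemma tensorOp_mul (S T : ZMod n → Matrix (NodeBasis w m) (NodeBasis w m) ℂ) :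
    tensorOp S * tensorOp T = tensorOp fun v => S v * T v := by
  ext x y
  simp only [tensorOp, mul_apply, Finset.prod_univ_sum, Fintype.piFinset_univ,
    Finset.prod_mul_distrib]

lemma conjTranspose_tensorOp (T : ZMod n → Matrix (NodeBasis w m) (NodeBasis w m) ℂ) :
    (tensorOp T)ᴴ = tensorOp fun v => (T v)ᴴ := by
  ext x y
  simp [tensorOp, conjTranspose_apply]

lemma sum_norm_sq_tensorOp_mulVec {T : ZMod n → Matrix (NodeBasis w m) (NodeBasis w m) ℂ}
    (hT : ∀ v, (T v).IsHermitian) (hT' : ∀ v, T v * T v = T v) (Ψ : RingBasis n w m → ℂ) :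
    ((∑ x, ‖(tensorOp T *ᵥ Ψ) x‖ ^ 2 : ℝ) : ℂ) =
      ∑ x, ∑ y, star (Ψ x) * (∏ v, T v (x v) (y v)) * Ψ y := by
  have h1 : ((∑ x, ‖(tensorOp T *ᵥ Ψ) x‖ ^ 2 : ℝ) : ℂ) =
      star (tensorOp T *ᵥ Ψ) ⬝ᵥ (tensorOp T *ᵥ Ψ) := by
    simp [dotProduct, Complex.conj_mul']
  have h2 : (tensorOp T)ᴴ = tensorOp T := by
    rw [conjTranspose_tensorOp]
    exact congrArg tensorOp (funext hT)
  rw [h1, star_mulVec, ← dotProduct_mulVec, mulVec_mulVec, h2, tensorOp_mul]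
  simp only [hT', dotProduct, mulVec, tensorOp, Finset.mul_sum, mul_assoc, Pi.star_apply]

end TensorOp

/-- The transfer matrix of the local operator `T`, from the (doubled) message register received by
a node to the one received by its successor, when every node holds the local state `ψ`. -/
noncomputable def transferMatrix {w m : ℕ} (ψ : NodeBasis w m → ℂ)
    (T : Matrix (NodeBasis w m) (NodeBasis w m) ℂ) :
    Matrix (Qubits m × Qubits m) (Qubits m × Qubits m) ℂ :=
  fun p q => ∑ ω : Qubits w × Qubits w,
    star (ψ (ω.1, q.1)) * T (ω.1, p.1) (ω.2, p.2) * ψ (ω.2, q.2)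

/-- Separates the workspaces from the messages in a pair of joint basis states. -/
def pairRegisters (V W M : Type) :
    (V → W × M) × (V → W × M) ≃ (V → M × M) × (V → W × W) where
  toFun z := (fun v => ((z.1 v).2, (z.2 v).2), fun v => ((z.1 v).1, (z.2 v).1))
  invFun z := (fun v => ((z.2 v).1, (z.1 v).1), fun v => ((z.2 v).2, (z.1 v).2))
  left_inv _ := rfl
  right_inv _ := rfl

lemma sum_ring_eq_trace {k w m : ℕ} (ψ : NodeBasis w m → ℂ)
    (T : Fin (k + 1) → Matrix (NodeBasis w m) (NodeBasis w m) ℂ) :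
    ∑ x : Fin (k + 1) → NodeBasis w m, ∑ y : Fin (k + 1) → NodeBasis w m,
        star (∏ v, ψ ((x v).1, (x (v + 1)).2)) * (∏ v, T v (x v) (y v)) *
          ∏ v, ψ ((y v).1, (y (v + 1)).2) =
      trace (List.ofFn fun v => transferMatrix ψ (T v)).prod := by
  rw [trace_prod_ofFn]
  simp only [transferMatrix, Finset.prod_univ_sum, Fintype.piFinset_univ]
  rw [← Fintype.sum_prod_type', ← Fintype.sum_prod_type',
    ← (pairRegisters (Fin (k + 1)) (Qubits w) (Qubits m)).sum_comp]
  refine Finset.sum_congr rfl fun z _ => ?_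
  rw [star_prod, ← Finset.prod_mul_distrib, ← Finset.prod_mul_distrib]
  rfl

/-! ### One-round algorithms as matrix-product processes. -/

namespace OneWayAlgorithm

variable {Color : Type} [Fintype Color] (A : OneWayAlgorithm Color)

/-- The state into which a node turns its memory before sending the message. -/
def localState : NodeBasis A.w A.m → ℂ := fun y => A.U y (fun _ => 0, fun _ => 0)

lemma sum_norm_sq_localState : ∑ y, star (A.localState y) * A.localState y = 1 := by
  have h := congrFun (congrFun (mem_unitaryGroup_iff'.mp A.unitary)
    (fun _ => 0, fun _ => 0)) (fun _ => 0, fun _ => 0)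
  rwa [mul_apply, one_apply_eq] at h

lemma finalState_one (n : ℕ) [NeZero n] (x : RingBasis n A.w A.m) :
    A.finalState n 1 x = ∏ v, A.localState ((x v).1, (x (v + 1)).2) := by
  rw [finalState, pow_one, initialState, mulVec_single_one, col_apply, mul_apply,
    Finset.sum_eq_single (fun v => ((x v).1, (x (v + 1)).2))]
  · rw [messaging, if_pos (by funext v; simp [passMessages]), one_mul]
    rfl
  · intro y _ hy
    rw [messaging, if_neg, zero_mul]
    rintro rfl
    exact hy (by funext v; simp [passMessages])
  · simp

/-- The transfer matrix of the event that a node outputs the color `c`. -/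
noncomputable def colorMatrix (c : Color) :
    Matrix (Qubits A.m × Qubits A.m) (Qubits A.m × Qubits A.m) ℂ :=
  transferMatrix A.localState (A.P c)

lemma outputProb_one_eq_trace (k : ℕ) (φ : Fin (k + 1) → Color) :
    (A.outputProb (k + 1) 1 φ : ℂ) = trace ((List.ofFn φ).map A.colorMatrix).prod := by
  have h := sum_ring_eq_trace A.localState fun v => A.P (φ v)
  rw [List.map_ofFn]
  refine Eq.trans ?_ h
  refine (sum_norm_sq_tensorOp_mulVec (n := k + 1) (T := fun v => A.P (φ v))
    (fun v => A.selfAdjoint _) (fun v => A.idempotent _) _).trans ?_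
  simp only [finalState_one]
  rfl

lemma outputProb_nonneg (n : ℕ) [NeZero n] (r : ℕ) (φ : ZMod n → Color) :
    0 ≤ A.outputProb n r φ :=
  Finset.sum_nonneg fun _ _ => by positivity

/-- Ignoring the outcome traces out the node: the received messages of bra and ket must agree, and
the message sent on is left in its reduced density matrix. -/
lemma sum_colorMatrix : ∑ c, A.colorMatrix c =
    vecMulVec (fun p => if p.1 = p.2 then 1 else 0)
      (fun q => ∑ ω, star (A.localState (ω, q.1)) * A.localState (ω, q.2)) := by
  have h : ∑ c, A.colorMatrix c = transferMatrix A.localState 1 := by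
    ext p q
    rw [← A.complete]
    simp only [colorMatrix, transferMatrix, Matrix.sum_apply, Finset.mul_sum, Finset.sum_mul]
    exact Finset.sum_comm
  rw [h]
  ext p q
  simp only [transferMatrix, vecMulVec_apply, Fintype.sum_prod_type, one_apply, Prod.mk.injEq]
  by_cases hp : p.1 = p.2 <;> simp [hp]

lemma isMatrixProduct_colorMatrix : IsMatrixProduct A.colorMatrix where
  sum_mul_mul_sum X := by
    rw [sum_colorMatrix]
    exact vecMulVec_mul_mul_vecMulVec _ _ X
  trace_sum := by
    rw [sum_colorMatrix, trace_vecMulVec]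
    refine Eq.trans ?_ A.sum_norm_sq_localState
    simp only [dotProduct, Fintype.sum_prod_type, ite_mul, one_mul, zero_mul, Finset.sum_ite_eq,
      Finset.mem_univ, if_true]
    rw [Finset.sum_comm]
  nonneg l := by
    rw [Finset.sum_mul, Matrix.trace_sum]
    refine Finset.sum_nonneg fun c _ => ?_
    -- Nonnegativity for every word comes from running the same algorithm on rings of every size.
    have h := A.outputProb_one_eq_trace l.length (fun i : Fin (l.length + 1) => (c :: l).get i)
    have h' : List.ofFn (fun i : Fin (l.length + 1) => (c :: l).get i) = c :: l :=
      List.ofFn_get (c :: l)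
    rw [h', List.map_cons, List.prod_cons] at h
    rw [← h]
    exact_mod_cast A.outputProb_nonneg _ _ _

end OneWayAlgorithm

/-! ### From proper colorings to blocks. -/

lemma isChain_ofFn_of_cyclic {Color : Type} {k : ℕ} {φ : Fin (k + 1) → Color}
    (hφ : ∀ v, φ v ≠ φ (v + 1)) : (List.ofFn φ).IsChain (· ≠ ·) := by
  rw [List.isChain_ofFn]
  intro i hi
  have hs : (⟨i, by omega⟩ : Fin (k + 1)) + 1 = ⟨i + 1, hi⟩ := by
    ext
    rw [Fin.val_add_one_of_lt' (by simpa using hi)]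
  exact hs ▸ hφ ⟨i, by omega⟩

lemma OneWayAlgorithm.outputProb_of_isProper_le {Color : Type} [Fintype Color]
    (A : OneWayAlgorithm Color) (k j : ℕ) (hj : 3 * j ≤ k + 1) (φ : Fin (k + 1) → Color)
    [Decidable (IsProper (n := k + 1) φ)] [Decidable (BlocksProper j (List.ofFn φ))] :
    (if IsProper (n := k + 1) φ then A.outputProb (k + 1) 1 φ else 0) ≤
      if BlocksProper j (List.ofFn φ) then
        (trace ((List.ofFn φ).map A.colorMatrix).prod).re else 0 := by
  rw [← A.outputProb_one_eq_trace, Complex.ofReal_re]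
  split_ifs with h1 h2 h2
  · exact le_rfl
  · exact absurd (blocksProper_of_isChain _ _ (isChain_ofFn_of_cyclic h1) (by simpa using hj)) h2
  · exact A.outputProb_nonneg _ _ _
  · exact le_rfl

end QuantumRing

theorem theorem1 (n : ℕ) [NeZero n] (A : QuantumRing.OneWayAlgorithm (Fin 3)) :
    A.successProb n 1 ≤ (11 / 15 : ℝ) ^ (n / 10) := by
  classical
  obtain ⟨k, rfl⟩ := Nat.exists_eq_add_one_of_ne_zero (NeZero.ne n)
  -- Of every ten nodes nine form blocks; at least one node stays free to cut the ring.
  refine le_trans ?_ (A.isMatrixProduct_colorMatrix.sum_blocksProper_le ((k + 1) / 10) (k + 1)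
    (by omega))
  rw [QuantumRing.OneWayAlgorithm.successProb, Finset.sum_filter]
  exact Finset.sum_le_sum fun φ _ => A.outputProb_of_isProper_le k _ (by omega) φ
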